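/- For an even integer $k\ge 0$ let $S_k$ be the space of cusp forms of weight $k$ for $\mathrm{SL}(2,\mathbb Z)$. For even $k\geq 0$, $k\ne 2$, write $k=12\ell+k'$ with $\ell\ge 0$ an integer and $k'\in\{0,4,6,8,10,14\}$. Let $q=e^{2\pi i\tau}$, let $E_{m}(\tau)=\frac12\sum_{\gcd(c,d)=1}(c\tau+d)^{-m}$ for even $m\ge 4$, let $E_0=1$, let $\Delta=q\prod_{n\ge1}(1-q^n)^{24}$, and let $j=E_4^3/\Delta$. For $D\ge 1$ let $$\mathcal E_D(t)=1+t+\dots+\frac{t^D}{D!}=\prod_{r=1}^D\bigl(1-z_{D,r}t\bigr),$$ so that $z_{D,1},\dots,z_{D,D}\in\mathbb C$ are the inverse zeros of $\mathcal E_D$. Fix $D\ge 1$ and $C>0$. There are constants $K$ and $k_0$ depending only on $D$ and $C$ such that the following holds for every even $k\ge k_0$, $k\neq 2$. Let $f\in S_k$ be a cusp form with $D\le\ell$ and $$f=q^{\ell-D}\bigl(1+a(1)q+\dots+a(D)q^D\bigr)+O\bigl(q^{\ell+1}\bigr),\qquad |a(i)|\le C\quad(1\le i\le D).$$ Then there is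 a unique polynomial $F_f\in\mathbb C[t]$ (the Faber polynomial of $f$) with $f=\Delta^\ell E_{k'}\cdot F_f(j)$, it has degree $D$, and its $D$ zeros $t_1,\dots,t_D$, listed with multiplicity and suitably labeled, satisfy $$\bigl|t_r-2k\,z_{D,r}\bigr|\le K\qquad(r=1,\dots,D).$$ In other words, $t_r=2k\cdot z_{D,r}+O(1)$ as $k\to\infty$, with an implied constant that depends only on $D$ and $C$. -/

import Mathlib

open scoped UpperHalfPlane MatrixGroups ModularForm

noncomputable section

namespace FaberZeros

/-- The truncated exponential polynomial `1 + t + t ^ 2 / 2! + ⋯ + t ^ D / D!`. -/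
def truncExp (D : ℕ) : Polynomial ℂ :=
  ∑ n ∈ Finset.range (D + 1), Polynomial.C (1 / (n.factorial : ℂ)) * Polynomial.X ^ n

/-- The normalized Eisenstein series `E_k` of level one as a function on the upper half plane
(`1 / 2` times the sum of `(c τ + d) ^ (-k)` over coprime pairs `(c, d)`) for `3 ≤ k`,
with the usual convention `E_0 = 1`. The value for `k = 1, 2` is immaterial. -/
def eisensteinE (k : ℕ) : ℍ → ℂ :=
  if hk : 3 ≤ k then ⇑(ModularForm.E hk) else fun _ => 1

/-- Klein's invariant `j = E_4 ^ 3 / Δ`. The discriminant `Δ` has no zeros on `ℍ`. -/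
def kleinJ (τ : ℍ) : ℂ :=
  eisensteinE 4 τ ^ 3 / ModularForm.discriminant τ

/-- `F` is a Faber polynomial of the function `f`, in the weight `12 * l + k'`:
`f = Δ ^ l * E_{k'} * F(j)` on the upper half plane. -/
def IsFaberPolynomial (l k' : ℕ) (f : ℍ → ℂ) (F : Polynomial ℂ) : Prop :=
  ∀ τ : ℍ, f τ = ModularForm.discriminant τ ^ l * eisensteinE k' τ * F.eval (kleinJ τ)

/-- `f` has a `q`-expansion of the form
`q ^ (l - D) * (1 + a(1) q + ⋯ + a(D) q ^ D) + O(q ^ (l + 1))` with `|a(i)| ≤ C`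
for `1 ≤ i ≤ D` (here `q = exp (2 π i τ)`, and `l - D` is a true difference). -/
structure HasDeepCusp (D l : ℕ) (C : ℝ) (f : ℍ → ℂ) : Prop where
  le : D ≤ l
  coeff_eq_zero : ∀ n < l - D, (UpperHalfPlane.qExpansion 1 f).coeff n = 0
  coeff_eq_one : (UpperHalfPlane.qExpansion 1 f).coeff (l - D) = 1
  norm_coeff_le : ∀ i ∈ Finset.Icc 1 D,
    ‖(UpperHalfPlane.qExpansion 1 f).coeff (l - D + i)‖ ≤ C

end FaberZeros

end

/-! ### Zeros of the truncated exponential and stability of roots. -/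

namespace FaberZeros

open Polynomial Finset

/-! Write `Δ = q P` with `P = 1 - 24 q + ⋯`, `A = E_4 ^ 3`, `J = A / P = q j`, and let `b m` be the
coefficient of `t ^ (D - m)` in `F`. Dividing `f = Δ ^ l E_{k'} F(j)` by `q ^ (l - D) E_{k'} P ^ l`
gives `∑ m, b m q ^ m J ^ (D - m) = P⁻¹ ^ l * γ / E_{k'}` up to `O(q ^ (D + 1))`, where `γ = 1 +
a(1) q + ⋯ + a(D) q ^ D`. Since `P⁻¹ = 1 + 24 q + ⋯`, the coefficients of `P⁻¹ ^ l` are `T ^ n / n!`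
with relative error `O(1 / T)`, where `T = 24 l` (`exists_expApprox_pow`). Multiplying by a series
with constant term 1 and bounded coefficients keeps this (`mul_powerSeries`), and so does solving
the unitriangular system for `b` (`of_triangular`). Hence `b m` is close to `T ^ m / m!`
(`exists_expApprox_faber`). So `F(T x)` is, up to `O(T ^ (D - 1))` for fixed `x`, `T ^ D` times the
reversed truncated exponential, whose zeros are the distinct `z_r`. Thus `F(T z_r) = O(T ^ (D -
1))`, which puts one root of `F` within `O(1)` of each `T z_r` (`exists_perm_norm_sub_le`,
`exists_roots_near`). Finally `2 k = T + 2 k'` with `k'` bounded. -/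

lemma coeff_truncExp (D n : ℕ) :
    (truncExp D).coeff n = if n ≤ D then 1 / (n.factorial : ℂ) else 0 := by
  simp [truncExp, Polynomial.coeff_X_pow]

lemma natDegree_truncExp (D : ℕ) : (truncExp D).natDegree = D := by
  apply le_antisymm
  · exact natDegree_le_iff_coeff_eq_zero.2 fun n hn ↦ by
      rw [coeff_truncExp, if_neg (by lia)]
  · exact le_natDegree_of_ne_zero (by simp [coeff_truncExp, Nat.factorial_ne_zero])

lemma derivative_truncExp (D : ℕ) :
    derivative (truncExp D) = truncExp D - C (1 / (D.factorial : ℂ)) * X ^ D := by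
  ext n
  rw [coeff_derivative, coeff_sub, coeff_C_mul_X_pow, coeff_truncExp, coeff_truncExp]
  have h1 : (n.factorial : ℂ) ≠ 0 := by exact_mod_cast n.factorial_ne_zero
  have h2 : (n + 1 : ℂ) ≠ 0 := by exact_mod_cast n.succ_ne_zero
  rcases lt_trichotomy n D with h | rfl | h
  · rw [if_pos (by lia), if_pos (by lia), if_neg (by lia), Nat.factorial_succ]
    push_cast
    field_simp
    ring
  · simp
  · simp [show ¬ (n + 1 ≤ D) by lia, show ¬ (n ≤ D) by lia, show n ≠ D by lia]

section InverseZeros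

variable {D : ℕ} {z : Fin D → ℂ}

/-- Degree count: a vanishing `z r` would leave at most `D - 1` linear factors. -/
lemma inverseZero_ne_zero
    (hz : truncExp D = ∏ r : Fin D, (1 - Polynomial.C (z r) * Polynomial.X)) (r : Fin D) :
    z r ≠ 0 := by
  intro h0
  have h1 : (truncExp D).natDegree ≤ ∑ s ∈ univ.erase r, 1 := by
    rw [hz, ← mul_prod_erase univ _ (mem_univ r), h0]
    simp only [map_zero, zero_mul, sub_zero, one_mul]
    refine (natDegree_prod_le _ _).trans (sum_le_sum fun s _ ↦ ?_)
    refine (natDegree_sub_le _ _).trans (max_le (by simp) ?_)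
    exact natDegree_C_mul_le _ _ |>.trans natDegree_X_le
  rw [natDegree_truncExp] at h1
  simp at h1
  have := r.2
  lia

lemma eval_truncExp_inv
    (hz : truncExp D = ∏ r : Fin D, (1 - Polynomial.C (z r) * Polynomial.X)) (r : Fin D) :
    (truncExp D).eval (z r)⁻¹ = 0 := by
  rw [hz, eval_prod]
  exact prod_eq_zero (mem_univ r) (by simp [inverseZero_ne_zero hz r])

/-- A double zero of the truncated exponential would also be a zero of its derivative, hence of
their difference `t ^ D / D!`; but `(z r)⁻¹ ≠ 0`. -/
lemma inverseZero_injective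
    (hz : truncExp D = ∏ r : Fin D, (1 - Polynomial.C (z r) * Polynomial.X)) :
    Function.Injective z := by
  intro r s hrs
  by_contra hne
  have hr := inverseZero_ne_zero hz r
  obtain ⟨p, hp⟩ : ∃ p, truncExp D = (1 - C (z r) * X) ^ 2 * p := by
    refine ⟨∏ i ∈ (univ.erase r).erase s, (1 - C (z i) * X), ?_⟩
    rw [hz, ← mul_prod_erase univ _ (mem_univ r), ← mul_prod_erase (univ.erase r) _
      (show s ∈ _ by simp [Ne.symm hne]), ← hrs]
    ring
  have h1 : (derivative (truncExp D)).eval (z r)⁻¹ = 0 := by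
    rw [hp]
    simp [derivative_mul, derivative_pow, hr]
  rw [derivative_truncExp, eval_sub, eval_truncExp_inv hz] at h1
  simp [hr, Nat.factorial_ne_zero] at h1

lemma sum_inverseZero_pow
    (hz : truncExp D = ∏ r : Fin D, (1 - Polynomial.C (z r) * Polynomial.X)) (r : Fin D) :
    ∑ m ∈ range (D + 1), 1 / (m.factorial : ℂ) * z r ^ (D - m) = 0 := by
  have hr := inverseZero_ne_zero hz r
  have h := eval_truncExp_inv hz r
  rw [truncExp, eval_finsetSum] at h
  have h2 := congrArg (z r ^ D * ·) h
  simp only [mul_sum, mul_zero] at h2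
  rw [← h2]
  refine sum_congr rfl fun m hm ↦ ?_
  have hm : m ≤ D := by simpa [Nat.lt_succ_iff] using hm
  have : z r ^ D = z r ^ (D - m) * z r ^ m := by rw [← pow_add]; congr 1; lia
  simp only [eval_mul, eval_C, eval_pow, eval_X, this, inv_pow]
  field_simp

end InverseZeros

/-- If each product `∏ i, |T z_r - t_i|` is `O(T ^ (D - 1))` with distinct `z_r`, then the `t_i` are,
after relabelling, within `O(1)` of the `T z_r`. -/
lemma exists_perm_norm_sub_le {D : ℕ} {z : Fin D → ℂ} (hz : Function.Injective z) (M : ℝ) :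
    ∃ K T₀ : ℝ, ∀ T : ℝ, T₀ ≤ T → ∀ t : Fin D → ℂ,
      (∀ r, (∏ i, ‖(T : ℂ) * z r - t i‖) * T ≤ M * T ^ D) →
      ∃ σ : Equiv.Perm (Fin D), ∀ r, ‖t (σ r) - T * z r‖ ≤ K := by
  obtain ⟨δ, hδ, hsep⟩ : ∃ δ : ℝ, 0 < δ ∧ ∀ r s, r ≠ s → 2 * δ ≤ ‖z r - z s‖ := by
    have h : ∀ p : Fin D × Fin D, ∃ δ : ℝ, 0 < δ ∧ (p.1 ≠ p.2 → 2 * δ ≤ ‖z p.1 - z p.2‖) := by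
      intro p
      by_cases hp : p.1 = p.2
      · exact ⟨1, one_pos, fun h ↦ (h hp).elim⟩
      · refine ⟨‖z p.1 - z p.2‖ / 2, ?_, fun _ ↦ by linarith⟩
        have : z p.1 - z p.2 ≠ 0 := sub_ne_zero.2 fun h ↦ hp (hz h)
        positivity
    choose d hd hd' using h
    rcases isEmpty_or_nonempty (Fin D × Fin D) with he | he
    · exact ⟨1, one_pos, fun r s ↦ (he.false (r, s)).elim⟩
    · obtain ⟨p, hp⟩ := Finite.exists_min d
      exact ⟨d p, hd p, fun r s hrs ↦ by linarith [hd' (r, s) hrs, hp (r, s)]⟩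
  -- The threshold makes `M < T δ ^ D`, so the factors of a product cannot all be at least `T δ`.
  -- The bound is what remains for one factor when the other `D - 1` are at least `T δ`.
  refine ⟨M / δ ^ (D - 1), max 1 (M / δ ^ D + 1), fun T hT t ht ↦ ?_⟩
  have hT0 : 0 < T := one_pos.trans_le ((le_max_left _ _).trans hT)
  have hT1 : M < T * δ ^ D := by
    have : M / δ ^ D < T := by linarith [(le_max_right _ _).trans hT]
    rwa [div_lt_iff₀ (by positivity)] at this
  have hex : ∀ r, ∃ i, ‖(T : ℂ) * z r - t i‖ < T * δ := by
    intro r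
    by_contra! hcon
    have h1 : (T * δ) ^ D ≤ ∏ i, ‖(T : ℂ) * z r - t i‖ := by
      have := Finset.prod_le_prod (s := (univ : Finset (Fin D))) (f := fun _ ↦ T * δ)
        (fun _ _ ↦ by positivity) (fun i _ ↦ hcon i)
      simpa using this
    have h2 := (mul_le_mul_of_nonneg_right h1 hT0.le).trans (ht r)
    have h3 : T ^ D * (T * δ ^ D) ≤ T ^ D * M := by
      rw [mul_pow] at h2; linarith
    have := le_of_mul_le_mul_left h3 (by positivity)
    linarith
  choose σ hσ using hex
  have key : ∀ r s, r ≠ s → 2 * (T * δ) ≤ ‖(T : ℂ) * z r - T * z s‖ := by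
    intro r s hrs
    rw [← mul_sub, norm_mul, Complex.norm_real, Real.norm_of_nonneg hT0.le]
    nlinarith [hsep r s hrs]
  -- The discs of radius `T δ` about the points `T z_r` are disjoint, so each contains its own
  -- `t_i`.
  have hinj : Function.Injective σ := by
    intro r s hrs
    by_contra hne
    have h1 := key r s hne
    have h2 := norm_sub_le ((T : ℂ) * z r - t (σ r)) (T * z s - t (σ s))
    rw [hrs, sub_sub_sub_cancel_right] at h2
    have h3 := hσ r
    rw [hrs] at h3
    linarith [hσ s]
  refine ⟨Equiv.ofBijective σ (Finite.injective_iff_bijective.1 hinj), fun r ↦ ?_⟩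
  rw [Equiv.ofBijective_apply, norm_sub_rev, le_div_iff₀ (by positivity)]
  have hsurj := Finite.surjective_of_injective hinj
  have h1 : (T * δ) ^ (D - 1) ≤ ∏ i ∈ univ.erase (σ r), ‖(T : ℂ) * z r - t i‖ := by
    have := Finset.prod_le_prod (s := univ.erase (σ r)) (f := fun _ ↦ T * δ)
        (g := fun i ↦ ‖(T : ℂ) * z r - t i‖) (fun _ _ ↦ by positivity) (fun i hi ↦ ?_)
    · simpa using this
    · obtain ⟨s, rfl⟩ := hsurj i
      have hrs : r ≠ s := fun h ↦ by simp [h] at hi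
      have h2 := norm_sub_le_norm_sub_add_norm_sub ((T : ℂ) * z r) (t (σ s)) (T * z s)
      have h3 := hσ s
      rw [norm_sub_rev] at h3
      linarith [key r s hrs]
  have h2 := ht r
  rw [← mul_prod_erase univ _ (mem_univ (σ r))] at h2
  have hD : T ^ D = T ^ (D - 1) * T := by
    rw [← pow_succ]; congr 1; have := r.2; lia
  have h3 : ‖(T : ℂ) * z r - t (σ r)‖ * (T * δ) ^ (D - 1) * T ≤ M * T ^ D :=
    le_trans (by gcongr) h2
  rw [hD, mul_pow] at h3
  have h4 : T ^ (D - 1) * T * (‖(T : ℂ) * z r - t (σ r)‖ * δ ^ (D - 1)) ≤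
      T ^ (D - 1) * T * M := by linarith
  exact le_of_mul_le_mul_left h4 (by positivity)

/-- `h n` agrees with `T ^ n / n!` for `n ≤ D` up to a relative error `O(1 / T)`. -/
def ExpApprox (D : ℕ) (T M : ℝ) (h : ℕ → ℂ) : Prop :=
  ∀ n ≤ D, ‖h n - (T : ℂ) ^ n / n.factorial‖ * T ≤ M * T ^ n

/-- At `T z_r` the main terms `T ^ m / m!` of the coefficients cancel by `sum_inverseZero_pow`; only
the coefficient errors survive, and these give `O(T ^ (D - 1))`. -/
lemma exists_roots_near {D : ℕ} {z : Fin D → ℂ}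
    (hz : truncExp D = ∏ r : Fin D, (1 - Polynomial.C (z r) * Polynomial.X)) (M : ℝ) :
    ∃ K T₀ : ℝ, ∀ T : ℝ, T₀ ≤ T → ∀ F : ℂ[X], F.natDegree = D → F.Monic →
      ExpApprox D T M (fun m ↦ F.coeff (D - m)) →
      ∃ t : Fin D → ℂ, F.roots = univ.val.map t ∧ ∀ r, ‖t r - T * z r‖ ≤ K := by
  obtain ⟨K, T₀, hK⟩ := exists_perm_norm_sub_le (inverseZero_injective hz)
    (∑ r, ∑ m ∈ range (D + 1), |M| * ‖z r‖ ^ (D - m))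
  refine ⟨K, max 1 T₀, fun T hT F hFD hF hA ↦ ?_⟩
  have hT0 : 0 < T := one_pos.trans_le ((le_max_left _ _).trans hT)
  obtain ⟨t, ht⟩ : ∃ t : Fin D → ℂ, F.roots = univ.val.map t := by
    have hc : F.roots.toList.length = D := by
      rw [Multiset.length_toList, ← hFD]
      exact (IsAlgClosed.splits F).natDegree_eq_card_roots.symm
    refine ⟨fun i ↦ F.roots.toList.get (i.cast hc.symm), ?_⟩
    subst hc
    rw [Fin.univ_val_map]
    exact (F.roots.coe_toList.symm.trans
      (congrArg Multiset.ofList (List.ofFn_get F.roots.toList).symm))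
  have hprod : F = ∏ i, (X - C (t i)) := by
    have := (IsAlgClosed.splits F).eq_prod_roots_of_monic hF
    rw [ht, Multiset.map_map] at this
    exact this
  suffices hle : ∀ r, (∏ i, ‖(T : ℂ) * z r - t i‖) * T ≤
      (∑ r, ∑ m ∈ range (D + 1), |M| * ‖z r‖ ^ (D - m)) * T ^ D by
    obtain ⟨σ, hσ⟩ := hK T ((le_max_right _ _).trans hT) t hle
    refine ⟨t ∘ σ, ?_, hσ⟩
    have h2 := congrArg Finset.val (Finset.map_univ_equiv σ)
    rw [Finset.map_val] at h2
    rw [ht, ← Multiset.map_map]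
    exact congrArg _ h2.symm
  intro r
  have h1 : ∏ i, ‖(T : ℂ) * z r - t i‖ = ‖F.eval (T * z r)‖ := by
    conv_rhs => rw [hprod]
    simp [eval_prod, norm_prod]
  have h2 : F.eval (T * z r) =
      ∑ m ∈ range (D + 1), (F.coeff (D - m) - (T : ℂ) ^ m / m.factorial) *
        (T * z r) ^ (D - m) := by
    have h3 : ∑ m ∈ range (D + 1), (T : ℂ) ^ m / m.factorial * (T * z r) ^ (D - m) = 0 := by
      have := congrArg ((T : ℂ) ^ D * ·) (sum_inverseZero_pow hz r)
      simp only [mul_sum, mul_zero] at this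
      rw [← this]
      refine sum_congr rfl fun m hm ↦ ?_
      have hm : m ≤ D := by simpa [Nat.lt_succ_iff] using hm
      have : (T : ℂ) ^ D = T ^ m * T ^ (D - m) := by rw [← pow_add]; congr 1; lia
      rw [this, mul_pow]
      ring
    simp only [sub_mul, sum_sub_distrib, h3, sub_zero]
    rw [eval_eq_sum_range, hFD, ← sum_range_reflect]
    refine sum_congr rfl fun m hm ↦ ?_
    rw [show D + 1 - 1 - m = D - m by lia]
  rw [h1, h2]
  calc ‖∑ m ∈ range (D + 1), (F.coeff (D - m) - (T : ℂ) ^ m / m.factorial) *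
        (T * z r) ^ (D - m)‖ * T
      ≤ (∑ m ∈ range (D + 1), ‖F.coeff (D - m) - (T : ℂ) ^ m / m.factorial‖ *
        (T * ‖z r‖) ^ (D - m)) * T := by
        gcongr
        refine (norm_sum_le _ _).trans (sum_le_sum fun m _ ↦ ?_)
        rw [norm_mul, norm_pow, norm_mul, Complex.norm_real, Real.norm_of_nonneg hT0.le]
    _ ≤ (∑ m ∈ range (D + 1), |M| * ‖z r‖ ^ (D - m)) * T ^ D := by
        rw [sum_mul, sum_mul]
        refine sum_le_sum fun m hm ↦ ?_
        have hm : m ≤ D := by simpa [Nat.lt_succ_iff] using hm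
        have h4 : ‖F.coeff (D - m) - (T : ℂ) ^ m / m.factorial‖ * T ≤ |M| * T ^ m :=
          (hA m hm).trans (by gcongr; exact le_abs_self M)
        have h5 : T ^ D = T ^ m * T ^ (D - m) := by rw [← pow_add]; congr 1; lia
        calc _ = (‖F.coeff (D - m) - (T : ℂ) ^ m / m.factorial‖ * T) *
              (T * ‖z r‖) ^ (D - m) := by ring
          _ ≤ |M| * T ^ m * (T * ‖z r‖) ^ (D - m) := by gcongr
          _ = _ := by rw [h5, mul_pow]; ring
    _ ≤ _ := by
        gcongr
        exact single_le_sum (f := fun r ↦ ∑ m ∈ range (D + 1), |M| * ‖z r‖ ^ (D - m))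
          (fun _ _ ↦ by positivity) (mem_univ r)

end FaberZeros

/-! ### Calculus of coefficient sequences close to those of `exp (T q)`. -/

namespace FaberZeros

open Finset

namespace ExpApprox

variable {D : ℕ} {T M : ℝ} {h : ℕ → ℂ}

/-- An entry of index below `n` is smaller than `T ^ n` by a factor `T`, so at index `n` it counts
only as error. -/
lemma norm_mul_le (hh : ExpApprox D T M h) (hT : 1 ≤ T) (hM : 0 ≤ M) {j n : ℕ} (hj : j ≤ D)
    (hjn : j < n) : ‖h j‖ * T ≤ (1 + M) * T ^ n := by
  have hT0 : 0 < T := by linarith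
  have h1 := hh j hj
  have h2 : ‖h j‖ ≤ ‖h j - (T : ℂ) ^ j / j.factorial‖ + ‖(T : ℂ) ^ j / j.factorial‖ := by
    simpa using norm_add_le (h j - (T : ℂ) ^ j / j.factorial) ((T : ℂ) ^ j / j.factorial)
  have h3 : ‖(T : ℂ) ^ j / j.factorial‖ ≤ T ^ j := by
    rw [norm_div, norm_pow, Complex.norm_real, Real.norm_of_nonneg hT0.le, Complex.norm_natCast]
    exact div_le_self (by positivity) (by exact_mod_cast j.factorial_pos)
  have h4 : T ^ j * T ≤ T ^ n := by
    rw [← pow_succ]; exact pow_le_pow_right₀ hT hjn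
  have h5 : T ^ j ≤ T ^ n := pow_le_pow_right₀ hT hjn.le
  calc ‖h j‖ * T ≤ (‖h j - (T : ℂ) ^ j / j.factorial‖ + T ^ j) * T := by gcongr; linarith
    _ = ‖h j - (T : ℂ) ^ j / j.factorial‖ * T + T ^ j * T := by ring
    _ ≤ M * T ^ n + T ^ n := by
      refine add_le_add (h1.trans (by gcongr)) h4
    _ = _ := by ring

lemma sum_norm_le (hh : ExpApprox D T M h) (hT : 1 ≤ T) (hM : 0 ≤ M) {B : ℝ}
    {w : ℕ → ℂ} {n : ℕ} (hn : n ≤ D + 1) (hw : ∀ j < n, ‖w j‖ ≤ B) :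
    ‖∑ j ∈ range n, h j * w j‖ * T ≤ n * ((1 + M) * B) * T ^ n := by
  have hT0 : 0 < T := by linarith
  calc ‖∑ j ∈ range n, h j * w j‖ * T ≤ (∑ j ∈ range n, ‖h j * w j‖) * T := by
        gcongr; exact norm_sum_le _ _
    _ ≤ ∑ j ∈ range n, (1 + M) * B * T ^ n := by
        rw [sum_mul]
        refine sum_le_sum fun j hj ↦ ?_
        have hj : j < n := by simpa using hj
        calc ‖h j * w j‖ * T = (‖h j‖ * T) * ‖w j‖ := by rw [norm_mul]; ring
          _ ≤ ((1 + M) * T ^ n) * B :=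
            mul_le_mul (hh.norm_mul_le hT hM (by lia) hj) (hw j hj) (norm_nonneg _) (by positivity)
          _ = _ := by ring
    _ = _ := by simp; ring

lemma mul_powerSeries {φ ψ : PowerSeries ℂ} (hφ : ExpApprox D T M (fun n ↦ φ.coeff n)) (hT : 1 ≤ T)
    (hM : 0 ≤ M) {B : ℝ} (hB : 0 ≤ B) (hψ0 : ψ.coeff 0 = 1) (hψ : ∀ i ≤ D, ‖ψ.coeff i‖ ≤ B) :
    ExpApprox D T (M + D * ((1 + M) * B)) (fun n ↦ (φ * ψ).coeff n) := by
  intro n hn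
  beta_reduce
  have hT0 : 0 < T := by linarith
  have h1 : (φ * ψ).coeff n = φ.coeff n + ∑ j ∈ range n, φ.coeff j * ψ.coeff (n - j) := by
    rw [PowerSeries.coeff_mul, Finset.Nat.sum_antidiagonal_eq_sum_range_succ
      (fun i j ↦ φ.coeff i * ψ.coeff j), sum_range_succ, Nat.sub_self, hψ0]
    ring
  have h2 := hφ.sum_norm_le hT hM (w := fun j ↦ ψ.coeff (n - j)) (n := n) (by lia)
    (fun j _ ↦ hψ _ (by lia))
  have h3 := hφ n hn
  calc _ ≤ (‖φ.coeff n - (T : ℂ) ^ n / n.factorial‖ +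
        ‖∑ j ∈ range n, φ.coeff j * ψ.coeff (n - j)‖) * T := by
        gcongr
        rw [h1, add_sub_right_comm]
        exact norm_add_le _ _
    _ ≤ M * T ^ n + n * ((1 + M) * B) * T ^ n := by rw [add_mul]; exact add_le_add h3 h2
    _ ≤ _ := by rw [add_mul M]; gcongr

/-- Forward substitution: in row `n` the off-diagonal sum involves only earlier `b j` and goes into
the error. Each row costs one application of the iterated map to the constant, hence `D + 1` of
them. -/
lemma of_triangular (hh : ExpApprox D T M h) (hT : 1 ≤ T) (hM : 0 ≤ M) {B : ℝ} (hB : 0 ≤ B)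
    {w : ℕ → ℕ → ℂ} (hw : ∀ n ≤ D, ∀ j < n, ‖w n j‖ ≤ B) {b : ℕ → ℂ}
    (hb : ∀ n ≤ D, h n = b n + ∑ j ∈ range n, b j * w n j) :
    ExpApprox D T ((fun x ↦ x + M + D * ((1 + x) * B))^[D + 1] 0) b := by
  have hT0 : 0 < T := by linarith
  set g : ℝ → ℝ := fun x ↦ x + M + D * ((1 + x) * B) with hg
  have hpos : ∀ n, 0 ≤ g^[n] 0 := by
    intro n
    induction n with
    | zero => simp
    | succ n ih => rw [Function.iterate_succ_apply', hg]; dsimp only; positivity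
  have key : ∀ n ≤ D, ExpApprox n T (g^[n + 1] 0) b := by
    intro n
    induction n with
    | zero =>
      intro hn m hm
      obtain rfl : m = 0 := by lia
      have h0 := hh 0 hn
      rw [hb 0 hn] at h0
      have hM' : M ≤ g^[0 + 1] 0 := by
        simp only [hg, zero_add, Function.iterate_one, add_zero, one_mul]
        have : 0 ≤ D * B := by positivity
        linarith
      refine le_trans ?_ (mul_le_mul_of_nonneg_right hM' (by positivity))
      simpa using h0
    | succ n ih =>
      intro hn m hm
      have ih := ih (by lia)
      have hx := hpos (n + 1)
      rw [Function.iterate_succ_apply']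
      set x := g^[n + 1] 0
      have hxg : g x = x + M + D * ((1 + x) * B) := rfl
      rcases Nat.lt_or_ge n m with hnm | hnm
      · obtain rfl : m = n + 1 := by lia
        have h1 := ih.sum_norm_le hT hx (w := w (n + 1)) (n := n + 1) le_rfl (hw _ hn)
        have h2 := hh (n + 1) hn
        rw [hb _ hn] at h2
        calc _ ≤ (‖b (n + 1) + ∑ j ∈ range (n + 1), b j * w (n + 1) j -
              (T : ℂ) ^ (n + 1) / (n + 1).factorial‖ +
              ‖∑ j ∈ range (n + 1), b j * w (n + 1) j‖) * T := by
              gcongr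
              refine le_trans (le_of_eq ?_) (norm_sub_le _ _)
              congr 1; ring
          _ ≤ M * T ^ (n + 1) + (n + 1 : ℕ) * ((1 + x) * B) * T ^ (n + 1) := by
              rw [add_mul]; exact add_le_add h2 h1
          _ ≤ (x + M + D * ((1 + x) * B)) * T ^ (n + 1) := by
              rw [← add_mul]
              gcongr
              linarith
      · refine (ih m hnm).trans ?_
        gcongr
        rw [hxg]
        have : 0 ≤ D * ((1 + x) * B) := by positivity
        linarith
  exact key D le_rfl

end ExpApprox

lemma pow_sub_descFactorial_le (N n : ℕ) :
    0 ≤ (N : ℝ) ^ n - N.descFactorial n ∧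
      ((N : ℝ) ^ n - N.descFactorial n) * N ≤ n ^ 2 * (N : ℝ) ^ n := by
  refine ⟨by rw [sub_nonneg]; exact_mod_cast Nat.descFactorial_le_pow N n, ?_⟩
  induction n with
  | zero => simp
  | succ n ih =>
    have h1 : (N.descFactorial (n + 1) : ℝ) = ((N : ℝ) - n) * N.descFactorial n := by
      rcases le_or_gt n N with h | h
      · rw [Nat.descFactorial_succ]; push_cast [h]; ring
      · rw [Nat.descFactorial_eq_zero_iff_lt.2 h, Nat.descFactorial_eq_zero_iff_lt.2 (by lia)]
        simp
    have h2 : (N.descFactorial n : ℝ) ≤ (N : ℝ) ^ n := by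
      exact_mod_cast Nat.descFactorial_le_pow N n
    have hN : (0 : ℝ) ≤ N := N.cast_nonneg
    have hn : (0 : ℝ) ≤ n := n.cast_nonneg
    rw [h1, pow_succ]
    push_cast
    have h3 := mul_le_mul_of_nonneg_right ih hN
    have h4 : (n : ℝ) * N.descFactorial n * N ≤ n * (N : ℝ) ^ n * N := by gcongr
    have h5 : 0 ≤ (n + 1) * ((N : ℝ) ^ n * N) := by positivity
    nlinarith

/-- As `R ^ j` has order at least `j`, the binomial sum may stop at `n`, a length independent of
`N`. -/
lemma coeff_one_add_pow {R : PowerSeries ℂ} (hR : R.constantCoeff = 0) (N n : ℕ) :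
    ((1 + R) ^ N).coeff n = ∑ j ∈ range (n + 1), (N.choose j : ℂ) * (R ^ j).coeff n := by
  have hvan : ∀ j, n < j → (R ^ j).coeff n = 0 := fun j hj ↦
    PowerSeries.coeff_of_lt_order _ (lt_of_lt_of_le (by exact_mod_cast hj)
      (PowerSeries.le_order_pow_of_constantCoeff_eq_zero j hR))
  have h1 : ((1 + R) ^ N).coeff n = ∑ j ∈ range (N + 1), (N.choose j : ℂ) * (R ^ j).coeff n := by
    rw [add_comm, add_pow, map_sum]
    refine sum_congr rfl fun j _ ↦ ?_
    rw [one_pow, mul_one, mul_comm, ← nsmul_eq_mul, map_nsmul, nsmul_eq_mul]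
  rw [h1]
  trans ∑ j ∈ range (max N n + 1), (N.choose j : ℂ) * (R ^ j).coeff n
  · refine sum_subset (range_mono (by lia)) fun j _ hj ↦ ?_
    rw [Nat.choose_eq_zero_of_lt (by simp at hj; lia)]; simp
  · refine (sum_subset (range_mono (by lia)) fun j _ hj ↦ ?_).symm
    rw [hvan j (by simp at hj; lia), mul_zero]

lemma coeff_pow_self {R : PowerSeries ℂ} (hR : R.constantCoeff = 0) (n : ℕ) :
    (R ^ n).coeff n = R.coeff 1 ^ n := by
  obtain ⟨S, rfl⟩ := PowerSeries.X_dvd_iff.2 hR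
  have h1 : (PowerSeries.X * S).coeff 1 = S.constantCoeff := by
    simp
  rw [mul_pow, h1]
  simpa using PowerSeries.coeff_X_pow_mul (S ^ n) n 0

/-- The coefficients of large powers of `1 + c q + ⋯` approximate those of `exp (c N q)`. -/
lemma exists_expApprox_pow (D : ℕ) {Q : PowerSeries ℂ} (hQ : Q.constantCoeff = 1) {c : ℝ}
    (hc : 1 ≤ c) (hQ1 : Q.coeff 1 = c) :
    ∃ M : ℝ, 0 ≤ M ∧ ∀ N : ℕ, 1 ≤ N → ExpApprox D (c * N) M (fun n ↦ (Q ^ N).coeff n) := by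
  set R := Q - 1 with hRdef
  have hR : R.constantCoeff = 0 := by simp [hRdef, hQ]
  have hR1 : R.coeff 1 = c := by simp [hRdef, hQ1, PowerSeries.coeff_one]
  have hQR : Q = 1 + R := by simp [hRdef]
  have hc0 : 0 < c := by linarith
  -- The first term pays for replacing `N.choose n` by `N ^ n / n!`, the sum for the binomial terms
  -- `j < n`. The factor `c` appears because the scale is `c * N` while the estimates are made
  -- against `N`.
  let B : ℕ → ℝ := fun n ↦ c * n ^ 2 + ∑ j ∈ range n, ‖(R ^ j).coeff n‖ * c
  have hB : ∀ n, 0 ≤ B n := fun n ↦ by positivity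
  refine ⟨∑ n ∈ range (D + 1), B n, sum_nonneg fun n _ ↦ hB n, fun N hN n hn ↦ ?_⟩
  beta_reduce
  have hN1 : (1 : ℝ) ≤ N := by exact_mod_cast hN
  have hBn : B n ≤ ∑ n ∈ range (D + 1), B n :=
    single_le_sum (f := B) (fun i _ ↦ hB i) (by simp; lia)
  refine le_trans ?_ (mul_le_mul_of_nonneg_right hBn (by positivity))
  have h1 : (Q ^ N).coeff n = ∑ j ∈ range n, (N.choose j : ℂ) * (R ^ j).coeff n +
      N.choose n * (c : ℂ) ^ n := by
    rw [hQR, coeff_one_add_pow hR, sum_range_succ, coeff_pow_self hR, hR1]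
  have h2 : ‖(N.choose n : ℂ) * (c : ℂ) ^ n - ((c * N : ℝ) : ℂ) ^ n / n.factorial‖ * N ≤
      n ^ 2 * (c * N) ^ n := by
    obtain ⟨h3, h4⟩ := pow_sub_descFactorial_le N n
    have hf : (n.factorial : ℂ) ≠ 0 := by exact_mod_cast n.factorial_ne_zero
    have hf1 : (1 : ℝ) ≤ n.factorial := by exact_mod_cast n.factorial_pos
    have h5 : (N.choose n : ℂ) * (c : ℂ) ^ n - ((c * N : ℝ) : ℂ) ^ n / n.factorial =
        (-(c ^ n * ((N : ℝ) ^ n - N.descFactorial n) / n.factorial : ℝ) : ℂ) := by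
      rw [Nat.descFactorial_eq_factorial_mul_choose]
      push_cast
      field_simp
      ring
    rw [h5, norm_neg, Complex.norm_real, Real.norm_of_nonneg (by positivity), mul_pow]
    calc _ ≤ c ^ n * ((N : ℝ) ^ n - N.descFactorial n) * N := by
          gcongr
          exact div_le_self (by positivity) hf1
      _ = c ^ n * (((N : ℝ) ^ n - N.descFactorial n) * N) := by ring
      _ ≤ c ^ n * (n ^ 2 * N ^ n) := by gcongr
      _ = _ := by ring
  have h6 : ‖∑ j ∈ range n, (N.choose j : ℂ) * (R ^ j).coeff n‖ * N ≤
      (∑ j ∈ range n, ‖(R ^ j).coeff n‖) * (c * N) ^ n := by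
    calc _ ≤ (∑ j ∈ range n, ‖(N.choose j : ℂ) * (R ^ j).coeff n‖) * N := by
          gcongr; exact norm_sum_le _ _
      _ ≤ _ := by
          rw [sum_mul, sum_mul]
          refine sum_le_sum fun j hj ↦ ?_
          have hj : j < n := by simpa using hj
          have h7 : (N.choose j : ℝ) * N ≤ (c * N) ^ n := by
            calc (N.choose j : ℝ) * N ≤ (N : ℝ) ^ j * N := by
                  gcongr; exact_mod_cast Nat.choose_le_pow N j
              _ = (N : ℝ) ^ (j + 1) := (pow_succ _ _).symm
              _ ≤ (N : ℝ) ^ n := pow_le_pow_right₀ hN1 hj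
              _ ≤ (c * N) ^ n := by gcongr; nlinarith
          rw [norm_mul, Complex.norm_natCast]
          calc _ = ‖(R ^ j).coeff n‖ * (N.choose j * N) := by ring
            _ ≤ _ := by gcongr
  calc _ ≤ (‖∑ j ∈ range n, (N.choose j : ℂ) * (R ^ j).coeff n‖ +
        ‖(N.choose n : ℂ) * (c : ℂ) ^ n - ((c * N : ℝ) : ℂ) ^ n / n.factorial‖) * (c * N) := by
        gcongr
        rw [h1, add_sub_assoc]
        exact norm_add_le _ _
    _ = c * (‖∑ j ∈ range n, (N.choose j : ℂ) * (R ^ j).coeff n‖ * N +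
        ‖(N.choose n : ℂ) * (c : ℂ) ^ n - ((c * N : ℝ) : ℂ) ^ n / n.factorial‖ * N) := by ring
    _ ≤ c * ((∑ j ∈ range n, ‖(R ^ j).coeff n‖) * (c * N) ^ n + n ^ 2 * (c * N) ^ n) := by
        gcongr
    _ = _ := by simp only [B, ← sum_mul]; ring

end FaberZeros

/-! ### Faber polynomials of level one modular forms: existence and uniqueness. -/

namespace FaberZeros

open UpperHalfPlane ModularForm Filter Topology Polynomial Finset

lemma modularForm_pow_apply {k : ℤ} (f : ModularForm 𝒮ℒ k) (n : ℕ) (τ : ℍ) :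
    f.pow n τ = f τ ^ n :=
  congrFun (ModularForm.coe_pow f n) τ

lemma eisensteinE_four : eisensteinE 4 = ⇑E₄ := by
  rw [eisensteinE, dif_pos (by norm_num)]

/-- In the weights `k'` that index the Faber polynomials, the space of modular forms is spanned by
the Eisenstein series. -/
lemma exists_modularForm_eisensteinE {k' : ℕ} (hk' : k' ∈ ({0, 4, 6, 8, 10, 14} : Finset ℕ)) :
    ∃ e : ModularForm 𝒮ℒ (k' : ℤ), ⇑e = eisensteinE k' ∧ (qExpansion 1 e).coeff 0 = 1 ∧
      ∀ g : ModularForm 𝒮ℒ (k' : ℤ), ∃ c : ℂ, c • e = g := by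
  have hev : Even k' := by
    simp only [mem_insert, mem_singleton] at hk'
    rcases hk' with rfl | rfl | rfl | rfl | rfl | rfl <;> decide
  have hrank : Module.finrank ℂ (ModularForm 𝒮ℒ (k' : ℤ)) = 1 := by
    rw [← Module.rank_eq_one_iff_finrank_eq_one, dimension_level_one k' hev]
    simp only [mem_insert, mem_singleton] at hk'
    rcases hk' with rfl | rfl | rfl | rfl | rfl | rfl <;> simp [Nat.ModEq]
  obtain ⟨e, he, he1⟩ : ∃ e : ModularForm 𝒮ℒ (k' : ℤ), ⇑e = eisensteinE k' ∧
      (qExpansion 1 e).coeff 0 = 1 := by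
    by_cases h3 : 3 ≤ k'
    · refine ⟨ModularForm.E h3, by rw [eisensteinE, dif_pos h3], ?_⟩
      exact EisensteinSeries.E_qExpansion_coeff_zero h3 hev
    · have h0 : k' = 0 := by
        simp only [mem_insert, mem_singleton] at hk'; lia
      subst h0
      refine ⟨ModularForm.mcast (by simp) (1 : ModularForm 𝒮ℒ 0), ?_, ?_⟩
      · ext τ; simp [eisensteinE]
      · rw [ModularForm.qExpansion_mcast, ModularForm.qExpansion_one]; simp
  refine ⟨e, he, he1, fun g ↦ ?_⟩
  refine (finrank_eq_one_iff_of_nonzero' e ?_).1 hrank g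
  rintro rfl
  simp [qExpansion_zero] at he1

/-- Induction on `n`: subtracting a multiple of `E_{k'} E_4 ^ (3 (n + 1))` kills the constant term,
and the resulting cusp form is divisible by `Δ`. The `q`-expansion identity uses `Δ ^ n j ^ i = E_4
^ (3 i) Δ ^ (n - i)`, which avoids the pole of `j` and stays within power series. -/
lemma exists_isFaberPolynomial {k' : ℕ} (hk' : k' ∈ ({0, 4, 6, 8, 10, 14} : Finset ℕ)) (n : ℕ)
    (g : ModularForm 𝒮ℒ ((12 * n + k' : ℕ) : ℤ)) :
    ∃ F : ℂ[X], F.natDegree ≤ n ∧ IsFaberPolynomial n k' g F ∧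
      qExpansion 1 g = qExpansion 1 (eisensteinE k') *
        ∑ i ∈ range (n + 1), F.coeff i •
          ((qExpansion 1 E₄ ^ 3) ^ i * qExpansion 1 discriminant ^ (n - i)) := by
  obtain ⟨e, he, he1, hspan⟩ := exists_modularForm_eisensteinE hk'
  rw [← he]
  induction n with
  | zero =>
    obtain ⟨c, hc⟩ := hspan (ModularForm.mcast (by simp) g)
    have hg : ⇑g = ⇑(c • e) := congrArg (fun f : ModularForm 𝒮ℒ (k' : ℤ) ↦ ⇑f) hc.symm
    refine ⟨C c, by simp, fun τ ↦ ?_, ?_⟩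
    · rw [hg, ← he]; simp [mul_comm]
    · rw [hg, FunLike.coe_smul, ModularForm.qExpansion_smul one_pos one_mem_strictPeriods_SL]
      simp
  | succ n ih =>
    set c := (qExpansion 1 g).coeff 0 with hc
    let b : ModularForm 𝒮ℒ ((12 * (n + 1) + k' : ℕ) : ℤ) :=
      ModularForm.mcast (by push_cast; ring) (e.mul (E₄.pow (3 * (n + 1))))
    have hb : ∀ τ, b τ = e τ * E₄ τ ^ (3 * (n + 1)) := fun τ ↦
      congrArg (e τ * ·) (modularForm_pow_apply E₄ _ τ)
    have hbq : qExpansion 1 b = qExpansion 1 e * qExpansion 1 E₄ ^ (3 * (n + 1)) := by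
      rw [ModularForm.qExpansion_mcast,
        ModularForm.qExpansion_mul one_pos one_mem_strictPeriods_SL,
        ModularForm.qExpansion_pow one_pos one_mem_strictPeriods_SL]
    have hE4 : (qExpansion 1 E₄).constantCoeff = 1 := by
      simpa using EisensteinSeries.E_qExpansion_coeff_zero (k := 4) (by norm_num) ⟨2, rfl⟩
    have hsub : qExpansion 1 ⇑(g - c • b) = qExpansion 1 g - c • qExpansion 1 b := by
      rw [FunLike.coe_sub, ModularForm.qExpansion_sub one_pos one_mem_strictPeriods_SL,
        FunLike.coe_smul, ModularForm.qExpansion_smul one_pos one_mem_strictPeriods_SL]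
    have h0 : (qExpansion 1 ⇑(g - c • b)).coeff 0 = 0 := by
      have he1' : (qExpansion 1 e).constantCoeff = 1 := by simpa using he1
      rw [hsub, map_sub, ← hc, hbq]
      simp [hE4, he1']
    have hfac := qExpansion_eq_qExpansion_discriminant_mul _ h0
    have hval := discriminant_mul_discriminantEquiv_apply (toCuspForm _ h0)
    set h := CuspForm.discriminantEquiv (toCuspForm _ h0)
    obtain ⟨F, hFd, hF, hFq⟩ := ih (ModularForm.mcast (by push_cast; ring) h)
    rw [ModularForm.qExpansion_mcast] at hFq
    refine ⟨F + C c * X ^ (n + 1), ?_, fun τ ↦ ?_, ?_⟩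
    · exact (natDegree_add_le _ _).trans (max_le (by lia) (natDegree_C_mul_X_pow_le _ _))
    · have h1 : g τ = discriminant τ * h τ + c * (e τ * E₄ τ ^ (3 * (n + 1))) := by
        rw [hval τ, ← hb τ]
        have : (toCuspForm _ h0) τ = (g - c • b) τ := rfl
        rw [this]
        simp
      have h2 : h τ = discriminant τ ^ n * e τ * F.eval (kleinJ τ) := by rw [he]; exact hF τ
      have h3 : discriminant τ ^ (n + 1) * kleinJ τ ^ (n + 1) = E₄ τ ^ (3 * (n + 1)) := by
        rw [← mul_pow, kleinJ, mul_div_cancel₀ _ (discriminant_ne_zero τ), pow_mul,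
          eisensteinE_four]
      rw [h1, h2, ← h3, ← he]
      simp only [eval_add, eval_mul, eval_C, eval_pow, eval_X]
      ring
    · have h1 : qExpansion 1 g = qExpansion 1 discriminant * qExpansion 1 h +
          c • qExpansion 1 b := by
        rw [← hfac, hsub, sub_add_cancel]
      have hFc : F.coeff (n + 1) = 0 := coeff_eq_zero_of_natDegree_lt (by lia)
      rw [h1, hbq, hFq, sum_range_succ _ (n + 1)]
      have h2 : ∀ i ∈ range (n + 1), (F + C c * X ^ (n + 1)).coeff i •
          ((qExpansion 1 E₄ ^ 3) ^ i * qExpansion 1 discriminant ^ (n + 1 - i)) =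
          qExpansion 1 discriminant * (F.coeff i •
          ((qExpansion 1 E₄ ^ 3) ^ i * qExpansion 1 discriminant ^ (n - i))) := by
        intro i hi
        have hi : i < n + 1 := by simpa using hi
        rw [coeff_add, coeff_C_mul_X_pow, if_neg (by lia), add_zero,
          show n + 1 - i = n - i + 1 by lia, pow_succ, mul_smul_comm]
        congr 1
        ring
      rw [sum_congr rfl h2, ← mul_sum, coeff_add, hFc, coeff_C_mul_X_pow, if_pos rfl, pow_mul]
      simp only [Nat.sub_self, pow_zero, mul_one, zero_add, mul_add, mul_smul_comm]
      ring

lemma tendsto_modularForm_atImInfty {k : ℤ} (f : ModularForm 𝒮ℒ k) :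
    Tendsto f atImInfty (𝓝 ((qExpansion 1 f).coeff 0)) := by
  have h1 := ModularFormClass.analyticAt_cuspFunction_zero f one_pos one_mem_strictPeriods_SL
  have h2 := h1.continuousAt.tendsto.comp (qParam_tendsto_atImInfty one_pos)
  have h3 : (qExpansion 1 f).coeff 0 = cuspFunction 1 f 0 := by simp [qExpansion_coeff]
  rw [h3]
  exact h2.congr fun τ ↦
    SlashInvariantFormClass.eq_cuspFunction f τ one_mem_strictPeriods_SL one_ne_zero

lemma tendsto_norm_kleinJ : Tendsto (fun τ ↦ ‖kleinJ τ‖) atImInfty atTop := by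
  have h4 : Tendsto (fun τ ↦ ‖E₄ τ ^ 3‖) atImInfty (𝓝 1) := by
    have := ((tendsto_modularForm_atImInfty E₄).pow 3).norm
    rw [EisensteinSeries.E_qExpansion_coeff_zero _ ⟨2, rfl⟩] at this
    simpa using this
  have hΔ : Tendsto (fun τ ↦ ‖discriminant τ‖⁻¹) atImInfty atTop := by
    refine Tendsto.inv_tendsto_nhdsGT_zero ?_
    refine tendsto_nhdsWithin_iff.2 ⟨?_, .of_forall fun τ ↦ ?_⟩
    · simpa using (show Tendsto discriminant atImInfty (𝓝 0) from
        discriminant_isZeroAtImInfty).norm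
    · simpa using discriminant_ne_zero τ
  refine (h4.pos_mul_atTop one_pos hΔ).congr fun τ ↦ ?_
  rw [kleinJ, eisensteinE_four, norm_div, div_eq_mul_inv]

/-- Near the cusp `E_{k'}` is nonzero, so the difference of two Faber polynomials vanishes at values
of `j`; these tend to infinity in norm. -/
lemma IsFaberPolynomial.unique {l k' : ℕ} (hk' : k' ∈ ({0, 4, 6, 8, 10, 14} : Finset ℕ))
    {f : ℍ → ℂ} {F G : ℂ[X]} (hF : IsFaberPolynomial l k' f F)
    (hG : IsFaberPolynomial l k' f G) : G = F := by
  obtain ⟨e, he, he1, -⟩ := exists_modularForm_eisensteinE hk'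
  have hne : ∀ᶠ τ in atImInfty, e τ ≠ 0 := by
    have := tendsto_modularForm_atImInfty e
    rw [he1] at this
    exact this.eventually_ne one_ne_zero
  have hev : ∀ᶠ τ in atImInfty, (G - F).eval (kleinJ τ) = 0 := by
    filter_upwards [hne] with τ hτ
    have h := (hG τ).symm.trans (hF τ)
    rw [← he] at h
    rw [eval_sub, sub_eq_zero]
    exact mul_left_cancel₀ (mul_ne_zero (pow_ne_zero _ (discriminant_ne_zero τ)) hτ) h
  by_contra hGF
  rcases lt_or_ge 0 (G - F).degree with hd | hd
  · have := ((G - F).tendsto_norm_atTop hd tendsto_norm_kleinJ).eventually_gt_atTop 0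
    obtain ⟨τ, h1, h2⟩ := (hev.and this).exists
    simp [h1] at h2
  · obtain ⟨τ, hτ⟩ := hev.exists
    rw [eq_C_of_degree_le_zero hd, eval_C] at hτ
    exact hGF (sub_eq_zero.1 (by rw [eq_C_of_degree_le_zero hd, hτ, C_0]))

/-- The `q`-expansion of `Δ` is `q - 24 q ^ 2 + O(q ^ 3)`. -/
lemma discriminant_qExpansion_coeff_two : (qExpansion 1 discriminant).coeff 2 = -24 := by
  let g : ModularForm 𝒮ℒ 12 :=
    ModularForm.mcast (by decide) (E₄.pow 3) - ModularForm.mcast (by decide) (E₆.pow 2)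
  have hg : discriminant = ⇑((1 / 1728 : ℂ) • g) := by
    ext τ
    have hgτ : g τ = E₄ τ ^ 3 - E₆ τ ^ 2 :=
      congrArg₂ (· - ·) (modularForm_pow_apply E₄ 3 τ) (modularForm_pow_apply E₆ 2 τ)
    rw [discriminant_eq_E₄_cube_sub_E₆_sq, FunLike.coe_smul, Pi.smul_apply, hgτ, smul_eq_mul]
    ring
  have hgq : qExpansion 1 g = qExpansion 1 E₄ * qExpansion 1 E₄ * qExpansion 1 E₄ -
      qExpansion 1 E₆ * qExpansion 1 E₆ := by
    simp only [g, FunLike.coe_sub, coe_mcast,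
      ModularForm.qExpansion_sub one_pos one_mem_strictPeriods_SL,
      ModularForm.qExpansion_pow one_pos one_mem_strictPeriods_SL]
    ring
  have h42 : (qExpansion 1 E₄).coeff 2 = 2160 := by
    rw [EisensteinSeries.E_qExpansion_coeff _ ⟨2, rfl⟩]
    norm_num [show _root_.bernoulli 4 = -1 / 30 by decide +kernel,
      show ArithmeticFunction.sigma 3 2 = 9 by decide +kernel]
  have h62 : (qExpansion 1 E₆).coeff 2 = -16632 := by
    rw [EisensteinSeries.E_qExpansion_coeff _ ⟨3, rfl⟩]
    norm_num [show _root_.bernoulli 6 = 1 / 42 by decide +kernel,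
      show ArithmeticFunction.sigma 5 2 = 33 by decide +kernel]
  rw [hg, FunLike.coe_smul, ModularForm.qExpansion_smul one_pos one_mem_strictPeriods_SL, hgq]
  norm_num [PowerSeries.coeff_mul, Finset.Nat.antidiagonal_succ, E₄_qExpansion_coeff_one,
    E₆_qExpansion_coeff_one, EisensteinSeries.E_qExpansion_coeff_zero _ ⟨2, rfl⟩,
    EisensteinSeries.E_qExpansion_coeff_zero _ ⟨3, rfl⟩, h42, h62]

end FaberZeros

/-! ### Coefficients of the Faber polynomial, and its zeros. -/

namespace FaberZeros

open UpperHalfPlane ModularForm Polynomial Finset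

section PowerSeries

variable {A E P φ : PowerSeries ℂ} {F : ℂ[X]} {D l : ℕ}

/-- Here `A`, `E`, `X * P` stand for the expansions of `E_4 ^ 3`, `E_{k'}`, `Δ`, so `A * P⁻¹` is
that of `q j`. Summing from the leading coefficient of `F` downwards exposes the exact power of `X`.
-/
lemma sum_smul_eq_X_pow_mul (hP : P.constantCoeff = 1) {d : ℕ} (hF : F.natDegree = d) (hd : d ≤ l)
    (hφ : φ = E * ∑ i ∈ range (l + 1), F.coeff i • (A ^ i * (PowerSeries.X * P) ^ (l - i))) :
    φ = PowerSeries.X ^ (l - d) * (E * P ^ l *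
      ∑ m ∈ range (d + 1), F.coeff (d - m) • (PowerSeries.X ^ m * (A * P⁻¹) ^ (d - m))) := by
  have hPi : P * P⁻¹ = 1 := PowerSeries.mul_inv_cancel P (by simp [hP])
  have h1 : ∑ i ∈ range (l + 1), F.coeff i • (A ^ i * (PowerSeries.X * P) ^ (l - i)) =
      ∑ i ∈ range (d + 1), F.coeff i • (A ^ i * (PowerSeries.X * P) ^ (l - i)) := by
    refine (sum_subset (range_mono (by lia)) fun i _ hi ↦ ?_).symm
    rw [coeff_eq_zero_of_natDegree_lt (by simp at hi; lia), zero_smul]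
  rw [hφ, h1, ← sum_range_reflect, mul_sum, mul_sum, mul_sum]
  refine sum_congr rfl fun m hm ↦ ?_
  have hm : m ≤ d := by simpa [Nat.lt_succ_iff] using hm
  have hPl : P ^ l * P⁻¹ ^ (d - m) = P ^ (l - (d - m)) := by
    rw [show l = (l - (d - m)) + (d - m) by lia, pow_add, mul_assoc, ← mul_pow, hPi, one_pow,
      mul_one]
    congr 1
    lia
  rw [show d + 1 - 1 - m = d - m by lia]
  simp only [mul_smul_comm]
  congr 1
  rw [mul_pow, mul_pow, ← hPl]
  have hX : (PowerSeries.X : PowerSeries ℂ) ^ (l - (d - m)) =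
      PowerSeries.X ^ (l - d) * PowerSeries.X ^ m := by rw [← pow_add]; congr 1; lia
  rw [hX]
  ring

lemma constantCoeff_faber_sum (hA : A.constantCoeff = 1) (hE : E.constantCoeff = 1)
    (hP : P.constantCoeff = 1) (d : ℕ) :
    (E * P ^ l * ∑ m ∈ range (d + 1),
      F.coeff (d - m) • (PowerSeries.X ^ m * (A * P⁻¹) ^ (d - m))).constantCoeff = F.coeff d := by
  simp [sum_range_succ', hA, hE, hP]

/-- The first nonzero coefficient of `φ` sits at `l - F.natDegree` and equals the leading
coefficient of `F`. Both degrees are at most `l`, so the truncated subtractions determine them. -/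
lemma natDegree_eq_and_monic (hA : A.constantCoeff = 1) (hE : E.constantCoeff = 1)
    (hP : P.constantCoeff = 1) (hF : F.natDegree ≤ l) (hD : D ≤ l)
    (hφ : φ = E * ∑ i ∈ range (l + 1), F.coeff i • (A ^ i * (PowerSeries.X * P) ^ (l - i)))
    (h0 : ∀ n < l - D, φ.coeff n = 0) (h1 : φ.coeff (l - D) = 1) :
    F.natDegree = D ∧ F.Monic := by
  have hX := sum_smul_eq_X_pow_mul hP rfl hF hφ
  have hF0 : F ≠ 0 := by
    rintro rfl
    simp [hφ] at h1
  have hlead : φ.coeff (l - F.natDegree) = F.leadingCoeff := by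
    rw [hX]
    have := PowerSeries.coeff_X_pow_mul (E * P ^ l * ∑ m ∈ range (F.natDegree + 1),
      F.coeff (F.natDegree - m) • (PowerSeries.X ^ m * (A * P⁻¹) ^ (F.natDegree - m)))
      (l - F.natDegree) 0
    rw [zero_add] at this
    rw [this, PowerSeries.coeff_zero_eq_constantCoeff_apply, constantCoeff_faber_sum hA hE hP,
      leadingCoeff]
  have hle : l - D ≤ l - F.natDegree := by
    by_contra! hlt
    exact hF0 (leadingCoeff_eq_zero.1 (hlead.symm.trans (h0 _ hlt)))
  have hge : l - F.natDegree ≤ l - D := by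
    by_contra! hlt
    rw [hX, PowerSeries.coeff_X_pow_mul', if_neg (by lia)] at h1
    exact zero_ne_one h1
  have hd : F.natDegree = D := by lia
  refine ⟨hd, ?_⟩
  rw [Monic, ← hlead, hd, h1]

lemma coeff_faber_sum (J : PowerSeries ℂ) (b : ℕ → ℂ) {n : ℕ} (hn : n ≤ D) :
    (∑ m ∈ range (D + 1), b m • (PowerSeries.X ^ m * J ^ (D - m))).coeff n =
      b n * (J ^ (D - n)).constantCoeff +
        ∑ m ∈ range n, b m * (J ^ (D - m)).coeff (n - m) := by
  rw [map_sum, ← sum_subset (range_mono (show n + 1 ≤ D + 1 by lia)), sum_range_succ, add_comm]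
  · congr 1
    · simp [PowerSeries.coeff_X_pow_mul']
    · refine sum_congr rfl fun m hm ↦ ?_
      rw [map_smul, PowerSeries.coeff_X_pow_mul', if_pos (by simp at hm; lia), smul_eq_mul]
  · intro m _ hm
    rw [map_smul, PowerSeries.coeff_X_pow_mul', if_neg (by simp at hm; lia), smul_zero]

/-- The power-series core: the coefficients of the Faber polynomial are those of
`t ^ D * exp (24 l / t)` up to a relative error `O(1 / l)`. -/
lemma exists_expApprox_faber (D : ℕ) {C : ℝ} (hC : 0 < C) (hA : A.constantCoeff = 1)
    (hE : E.constantCoeff = 1) (hP : P.constantCoeff = 1) (hP1 : P.coeff 1 = -24) :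
    ∃ M : ℝ, ∀ (l : ℕ) (F : ℂ[X]) (φ : PowerSeries ℂ), 1 ≤ l → D ≤ l → F.natDegree = D →
      φ = E * ∑ i ∈ range (l + 1), F.coeff i • (A ^ i * (PowerSeries.X * P) ^ (l - i)) →
      φ.coeff (l - D) = 1 → (∀ i ∈ Icc 1 D, ‖φ.coeff (l - D + i)‖ ≤ C) →
      ExpApprox D (24 * l) M (fun m ↦ F.coeff (D - m)) := by
  have hPi : P * P⁻¹ = 1 := PowerSeries.mul_inv_cancel P (by simp [hP])
  have hEi : E * E⁻¹ = 1 := PowerSeries.mul_inv_cancel E (by simp [hE])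
  have hQ : P⁻¹.constantCoeff = 1 := by simp [hP]
  have hQ1 : P⁻¹.coeff 1 = ((24 : ℝ) : ℂ) := by
    have := congrArg (PowerSeries.coeff 1) hPi
    rw [PowerSeries.coeff_mul, Finset.Nat.antidiagonal_succ] at this
    simp [PowerSeries.coeff_one, hP, hP1] at this
    rw [add_neg_eq_zero] at this
    simpa using this
  obtain ⟨M₀, hM₀, hQpow⟩ := exists_expApprox_pow D hQ (by norm_num) hQ1
  set J := A * P⁻¹
  -- `BU` bounds the coefficients of `γ * E⁻¹`, and `BW` the entries of the triangular system;
  -- neither depends on `l` or on the form.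
  set BU : ℝ := (1 + C) * ∑ b ∈ range (D + 1), ‖E⁻¹.coeff b‖ with hBU
  set BW : ℝ := ∑ n ∈ range (D + 1), ∑ j ∈ range (D + 1), ‖(J ^ (D - j)).coeff (n - j)‖ with hBW
  have hBU0 : 0 ≤ BU := by positivity
  have hBW0 : 0 ≤ BW := by positivity
  set M₁ : ℝ := M₀ + D * ((1 + M₀) * BU)
  refine ⟨(fun x ↦ x + M₁ + D * ((1 + x) * BW))^[D + 1] 0, fun l F φ hl hDl hF hφ h1 hCb ↦ ?_⟩
  have hT : (1 : ℝ) ≤ 24 * l := by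
    have : (1 : ℝ) ≤ l := by exact_mod_cast hl
    linarith
  set S := ∑ m ∈ range (D + 1), F.coeff (D - m) • (PowerSeries.X ^ m * J ^ (D - m)) with hS
  set γ := E * P ^ l * S with hγ
  have hX : φ = PowerSeries.X ^ (l - D) * γ := sum_smul_eq_X_pow_mul hP hF hDl hφ
  have hγc : ∀ i, γ.coeff i = φ.coeff (l - D + i) := fun i ↦ by
    rw [hX, add_comm, PowerSeries.coeff_X_pow_mul]
  have hγ0 : γ.coeff 0 = 1 := by rw [hγc, add_zero, h1]
  have hγb : ∀ i ≤ D, ‖γ.coeff i‖ ≤ 1 + C := by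
    intro i hi
    rcases Nat.eq_zero_or_pos i with rfl | hi0
    · rw [hγ0, norm_one]; linarith
    · rw [hγc]; linarith [hCb i (by simp; lia)]
  have hSeq : P⁻¹ ^ l * (γ * E⁻¹) = S := by
    have : P⁻¹ ^ l * P ^ l = 1 := by rw [← mul_pow, mul_comm, hPi, one_pow]
    calc P⁻¹ ^ l * (γ * E⁻¹) = (P⁻¹ ^ l * P ^ l) * (E * E⁻¹) * S := by rw [hγ]; ring
      _ = S := by rw [this, hEi, one_mul, one_mul]
  have hU0 : (γ * E⁻¹).coeff 0 = 1 := by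
    have : γ.constantCoeff = 1 := by simpa using hγ0
    simp [this, hE]
  have hUb : ∀ i ≤ D, ‖(γ * E⁻¹).coeff i‖ ≤ BU := by
    intro i hi
    rw [mul_comm, PowerSeries.coeff_mul, Finset.Nat.sum_antidiagonal_eq_sum_range_succ
      (fun i j ↦ E⁻¹.coeff i * γ.coeff j)]
    calc _ ≤ ∑ b ∈ range (i + 1), (1 + C) * ‖E⁻¹.coeff b‖ := by
          refine (norm_sum_le _ _).trans (sum_le_sum fun b hb ↦ ?_)
          rw [norm_mul, mul_comm]
          gcongr
          exact hγb _ (by lia)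
      _ ≤ BU := by
          rw [← mul_sum, hBU]
          gcongr
  have hSapp := (hQpow l hl).mul_powerSeries hT hM₀ hBU0 hU0 hUb
  rw [hSeq] at hSapp
  have hJ : J.constantCoeff = 1 := by simp [J, hA, hP]
  refine hSapp.of_triangular hT (by positivity) hBW0
    (w := fun n m ↦ (J ^ (D - m)).coeff (n - m)) (fun n hn j hj ↦ ?_) (fun n hn ↦ ?_)
  · rw [hBW]
    refine le_trans ?_ (single_le_sum
      (f := fun n ↦ ∑ j ∈ range (D + 1), ‖(J ^ (D - j)).coeff (n - j)‖)
      (fun _ _ ↦ by positivity) (show n ∈ range (D + 1) by simp; lia))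
    exact single_le_sum (f := fun j ↦ ‖(J ^ (D - j)).coeff (n - j)‖)
      (fun _ _ ↦ by positivity) (show j ∈ range (D + 1) by simp; lia)
  · rw [hS, coeff_faber_sum J (fun m ↦ F.coeff (D - m)) hn]
    simp [hJ]

end PowerSeries

lemma exists_zeros_near_of_weight (D : ℕ) (hD : 1 ≤ D) {C : ℝ} (hC : 0 < C) {z : Fin D → ℂ}
    (hz : truncExp D = ∏ r : Fin D, (1 - Polynomial.C (z r) * Polynomial.X)) {k' : ℕ}
    (hk' : k' ∈ ({0, 4, 6, 8, 10, 14} : Finset ℕ)) :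
    ∃ (K : ℝ) (k₀ : ℕ), ∀ k l : ℕ, k₀ ≤ k → k = 12 * l + k' →
      ∀ f : CuspForm 𝒮ℒ (k : ℤ), HasDeepCusp D l C f →
        ∃ F : ℂ[X], (∀ G : ℂ[X], IsFaberPolynomial l k' f G ↔ G = F) ∧ F.natDegree = D ∧
          ∃ t : Fin D → ℂ, F.roots = univ.val.map t ∧ ∀ r, ‖t r - 2 * (k : ℂ) * z r‖ ≤ K := by
  obtain ⟨e, he, he1, -⟩ := exists_modularForm_eisensteinE hk'
  have hΔ0 : (qExpansion 1 discriminant).constantCoeff = 0 := by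
    simpa using PowerSeries.coeff_of_lt_order 0
      (show ((0 : ℕ) : ℕ∞) < (qExpansion 1 discriminant).order by
        rw [discriminant_qExpansion_order]; norm_num)
  obtain ⟨P, hΔ⟩ := PowerSeries.X_dvd_iff.2 hΔ0
  have hΔ1 := discriminant_qExpansion_coeff_one
  have hΔ2 := discriminant_qExpansion_coeff_two
  rw [hΔ, PowerSeries.coeff_succ_X_mul] at hΔ1 hΔ2
  have hP : P.constantCoeff = 1 := by simpa using hΔ1
  have hA : (qExpansion 1 E₄ ^ 3).constantCoeff = 1 := by
    have : (qExpansion 1 E₄).constantCoeff = 1 := by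
      simpa using EisensteinSeries.E_qExpansion_coeff_zero (k := 4) (by norm_num) ⟨2, rfl⟩
    simp [this]
  have hE : (qExpansion 1 (eisensteinE k')).constantCoeff = 1 := by rw [← he]; simpa using he1
  obtain ⟨M, hM⟩ := exists_expApprox_faber D hC hA hE hP hΔ2
  obtain ⟨K, T₀, hK⟩ := exists_roots_near hz M
  -- The extra sum pays for passing from `24 l` to `2 k = 24 l + 2 k'`; the bound on `k` forces `12
  -- l ≥ T₀`.
  refine ⟨K + ∑ r, 2 * k' * ‖z r‖, ⌈T₀⌉₊ + k', fun k l hk hkl f hf ↦ ?_⟩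
  subst hkl
  obtain ⟨F, hFl, hFab, hFq⟩ := exists_isFaberPolynomial hk' l (CuspForm.toModularFormₗ f)
  have hfc : ⇑(CuspForm.toModularFormₗ f) = ⇑f := rfl
  rw [hfc] at hFab hFq
  rw [hΔ] at hFq
  obtain ⟨hFD, hFm⟩ := natDegree_eq_and_monic hA hE hP hFl hf.le hFq hf.coeff_eq_zero
    hf.coeff_eq_one
  have happ := hM l F _ (hD.trans hf.le) hf.le hFD hFq hf.coeff_eq_one hf.norm_coeff_le
  have hT : T₀ ≤ 24 * l := by
    have h1 : ⌈T₀⌉₊ ≤ 12 * l := by lia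
    have h2 : (⌈T₀⌉₊ : ℝ) ≤ 12 * l := by exact_mod_cast h1
    have h3 := Nat.le_ceil T₀
    have h4 : (0 : ℝ) ≤ l := l.cast_nonneg
    linarith
  obtain ⟨t, ht, htK⟩ := hK _ hT F hFD hFm happ
  refine ⟨F, fun G ↦ ⟨fun hG ↦ hFab.unique hk' hG, fun h ↦ h ▸ hFab⟩, hFD, t, ht, fun r ↦ ?_⟩
  have h1 : t r - 2 * ((12 * l + k' : ℕ) : ℂ) * z r =
      (t r - ((24 * l : ℝ) : ℂ) * z r) - 2 * k' * z r := by
    push_cast; ring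
  have h2 : ‖2 * (k' : ℂ) * z r‖ = 2 * k' * ‖z r‖ := by simp
  rw [h1]
  refine (norm_sub_le _ _).trans (add_le_add (htK r) ?_)
  rw [h2]
  exact single_le_sum (f := fun r ↦ 2 * (k' : ℝ) * ‖z r‖) (fun _ _ ↦ by positivity) (mem_univ r)

end FaberZeros
theorem corollary1p3 (D : ℕ) (hD : 1 ≤ D) (C : ℝ) (hC : 0 < C)
    (z : Fin D → ℂ)
    (hz : FaberZeros.truncExp D =
      ∏ r : Fin D, (1 - Polynomial.C (z r) * Polynomial.X)) :
    ∃ (K : ℝ) (k₀ : ℕ), ∀ k l k' : ℕ, k₀ ≤ k → k = 12 * l + k' →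
      k' ∈ ({0, 4, 6, 8, 10, 14} : Finset ℕ) →
      ∀ f : CuspForm 𝒮ℒ (k : ℤ), FaberZeros.HasDeepCusp D l C f →
        ∃ F : Polynomial ℂ,
          (∀ G : Polynomial ℂ, FaberZeros.IsFaberPolynomial l k' f G ↔ G = F) ∧
          F.natDegree = D ∧
          ∃ t : Fin D → ℂ, F.roots = Finset.univ.val.map t ∧
            ∀ r : Fin D, ‖t r - 2 * (k : ℂ) * z r‖ ≤ K := by
 
  -- Membership is placed under the existential so that constants can be chosen for every `k'`;
  -- summing over the six admissible values makes them uniform.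
  have hex : ∀ k' : ℕ, ∃ (K : ℝ) (k₀ : ℕ), k' ∈ ({0, 4, 6, 8, 10, 14} : Finset ℕ) →
      ∀ k l : ℕ, k₀ ≤ k → k = 12 * l + k' →
      ∀ f : CuspForm 𝒮ℒ (k : ℤ), FaberZeros.HasDeepCusp D l C f →
        ∃ F : Polynomial ℂ, (∀ G : Polynomial ℂ, FaberZeros.IsFaberPolynomial l k' f G ↔ G = F) ∧
          F.natDegree = D ∧ ∃ t : Fin D → ℂ, F.roots = Finset.univ.val.map t ∧
            ∀ r : Fin D, ‖t r - 2 * (k : ℂ) * z r‖ ≤ K := by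
    intro k'
    by_cases hk' : k' ∈ ({0, 4, 6, 8, 10, 14} : Finset ℕ)
    · obtain ⟨K, k₀, h⟩ := FaberZeros.exists_zeros_near_of_weight D hD hC hz hk'
      exact ⟨K, k₀, fun _ ↦ h⟩
    · exact ⟨0, 0, fun h ↦ (hk' h).elim⟩
  choose K k₀ h using hex
  refine ⟨∑ k' ∈ {0, 4, 6, 8, 10, 14}, |K k'|, ∑ k' ∈ {0, 4, 6, 8, 10, 14}, k₀ k',
    fun k l k' hk hkl hk' f hf ↦ ?_⟩
  have hk₀ : k₀ k' ≤ k :=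
    (Finset.single_le_sum (f := k₀) (fun _ _ ↦ Nat.zero_le _) hk').trans hk
  obtain ⟨F, hF, hFD, t, ht, htK⟩ := h k' hk' k l hk₀ hkl f hf
  refine ⟨F, hF, hFD, t, ht, fun r ↦ (htK r).trans ((le_abs_self _).trans ?_)⟩
  exact Finset.single_le_sum (f := fun k' ↦ |K k'|) (fun _ _ ↦ abs_nonneg _) hk'
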